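/- Let $\Gamma\subset\mathrm{PSL}_2(\mathbb R)$ be a Fuchsian group of the first kind with finite covolume (that is, $\Gamma$ is discrete and has a fundamental domain of finite hyperbolic area), acting on the upper half-plane $\mathbb H$ by fractional linear transformations. Let $M=\Gamma\backslash\mathbb H$ with projection $p:\mathbb H\to M$, let $d_{\mathrm{hyp}}$ be the hyperbolic distance on $\mathbb H$, and let $ds_{\mathrm{hyp}}=\sqrt{dx^2+dy^2}/y$. Let $\gamma\in\Gamma$ be hyperbolic and primitive (not of the form $\delta^n$ with $\delta\in\Gamma$, $n\ge 2$). Let $\sigma_\gamma\in\mathrm{PSL}_2(\mathbb R)$ and $\ell_\gamma>0$ be such that $\sigma_\gamma^{-1}\gamma\sigma_\gamma=\begin{pmatrix}e^{\ell_\gamma/2}&0\\0&e^{-\ell_\gamma/2}\end{pmatrix}$. Put $\mathcal L_\gamma=\sigma_\gamma\{z\in\mathbb H:\mathrm{Re}(z)=0\}$, let $L_\gamma$ be the closed geodesic $[0,\ell_\gamma]\ni\rho\mapsto p(\sigma_\gamma(e^{\rho}i))$ of length $\ell_\gamma$ on $M$ (integrals over $L_\gamma$ are taken along this closed curve, traversed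 once), and let $\Gamma_\gamma=\langle\gamma\rangle$. For $z,w\in\mathbb H$ and $s\in\mathbb C$ with $\mathrm{Re}(s)>1$ let $$K_s(z,w)=\sum_{\eta\in\Gamma}\cosh\bigl(d_{\mathrm{hyp}}(z,\eta w)\bigr)^{-s},\qquad \mathcal E^{\mathrm{hyp}}_\gamma(z,s)=\sum_{\eta\in\Gamma_\gamma\backslash\Gamma}\cosh\bigl(d_{\mathrm{hyp}}(\eta z,\mathcal L_\gamma)\bigr)^{-s},$$ which are $\Gamma$-invariant in each of the variables $z,w$ and hence are regarded as functions on $M\times M$ and $M$. Then $\Gamma_\gamma$ is the stabilizer (centralizer) of $\gamma$ in $\Gamma$, and for all $z,w\in M$ and $s\in\mathbb C$ with $\mathrm{Re}(s)>1$ both series converge absolutely, the function $w\mapsto K_s(z,w)$ is integrable along $L_\gamma$, and $$\int_{L_\gamma}K_s(z,w)\,ds_{\mathrm{hyp}}(w)=\frac{2^{s-1}\,\Gamma(\frac s2)^2}{\Gamma(s)}\;\mathcal E^{\mathrm{hyp}}_\gamma(z,s).$$ -/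

import Mathlib

open MeasureTheory UpperHalfPlane
open scoped MatrixGroups

noncomputable section

namespace HypEis

/-! ### The action of `PSL(2, ℝ)` on the upper half-plane -/

lemma center_smul (A : SL(2, ℝ)) (hA : A ∈ Subgroup.center SL(2, ℝ)) (z : ℍ) : A • z = z := by
  obtain ⟨r, hr, hA'⟩ := Matrix.SpecialLinearGroup.mem_center_iff.mp hA
  have hr0 : (r : ℂ) ≠ 0 := by
    intro h
    have : r = 0 := by exact_mod_cast h
    simp [this] at hr
  have h00 : A 0 0 = r := by rw [← hA']; simp
  have h01 : A 0 1 = 0 := by rw [← hA']; simp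
  have h10 : A 1 0 = 0 := by rw [← hA']; simp
  have h11 : A 1 1 = r := by rw [← hA']; simp
  apply UpperHalfPlane.ext
  rw [UpperHalfPlane.coe_specialLinearGroup_apply]
  simp [h00, h01, h10, h11]
  field_simp

/-- The homomorphism from `PSL(2, ℝ)` to permutations of `ℍ` induced by fractional linear
transformations. -/
def pslToPerm : PSL(2, ℝ) →* Equiv.Perm ℍ :=
  QuotientGroup.lift (Subgroup.center SL(2, ℝ)) (MulAction.toPermHom SL(2, ℝ) ℍ)
    (fun A hA => Equiv.ext fun z => center_smul A hA z)

/-- `PSL(2, ℝ)` acts on `ℍ` by fractional linear transformations. -/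
instance pslAction : MulAction PSL(2, ℝ) ℍ := MulAction.compHom ℍ pslToPerm

lemma mk_smul (A : SL(2, ℝ)) (z : ℍ) : (QuotientGroup.mk A : PSL(2, ℝ)) • z = A • z := rfl

instance pslIsometric : IsIsometricSMul PSL(2, ℝ) ℍ :=
  ⟨fun g => by
    induction g using QuotientGroup.induction_on with
    | H A => exact isometry_smul ℍ A⟩

/-! ### Fuchsian groups and the quotient surface -/

/-- `Γ` is a Fuchsian group of the first kind with finite volume quotient: it is discrete in
`PSL(2, ℝ)` and has a fundamental domain of finite hyperbolic area. -/
structure IsFuchsianFirstKind (Γ : Subgroup PSL(2, ℝ)) : Prop where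
  discrete : DiscreteTopology Γ
  finite_covolume : ∃ F : Set ℍ, IsFundamentalDomain Γ F (volume : Measure ℍ) ∧
    (volume : Measure ℍ) F < ⊤

/-- The surface `M = Γ \ ℍ`. -/
abbrev Surface (Γ : Subgroup PSL(2, ℝ)) : Type := MulAction.orbitRel.Quotient Γ ℍ

/-- The projection `p : ℍ → M`. -/
def proj (Γ : Subgroup PSL(2, ℝ)) (z : ℍ) : Surface Γ := Quotient.mk _ z

/-- An element of `PSL(2, ℝ)` is hyperbolic if its representatives in `SL(2, ℝ)` are, i.e. have
two distinct real eigenvalues. -/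
def IsHyperbolic (g : PSL(2, ℝ)) : Prop :=
  ∃ A : SL(2, ℝ), (QuotientGroup.mk A : PSL(2, ℝ)) = g ∧
    (A : Matrix (Fin 2) (Fin 2) ℝ).IsHyperbolic

/-- An element of `Γ` is primitive if it is not a proper power of an element of `Γ`. -/
def IsPrimitive {Γ : Subgroup PSL(2, ℝ)} (γ : Γ) : Prop :=
  ∀ (δ : Γ) (n : ℕ), 2 ≤ n → δ ^ n ≠ γ

/-! ### Scaling matrices, the axis and the closed geodesic -/

/-- The matrix `diag(e^{ℓ/2}, e^{-ℓ/2})`. -/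
def diagExp (ℓ : ℝ) : SL(2, ℝ) :=
  ⟨!![Real.exp (ℓ / 2), 0; 0, Real.exp (-ℓ / 2)], by
    rw [Matrix.det_fin_two_of, ← Real.exp_add]; simp [neg_div]⟩

/-- A scaling matrix for `γ`: an element `σ` of `PSL(2, ℝ)` with
`σ⁻¹ γ σ = diag(e^{ℓ/2}, e^{-ℓ/2})` for some `ℓ > 0`; the number `ℓ` is the length of the closed
geodesic determined by `γ`. -/
structure Scaling (γ : PSL(2, ℝ)) where
  σ : PSL(2, ℝ)
  ℓ : ℝ
  ℓ_pos : 0 < ℓ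
  conj_eq : σ⁻¹ * γ * σ = (QuotientGroup.mk (diagExp ℓ) : PSL(2, ℝ))

/-- The point `e^t i`. -/
def expI (t : ℝ) : ℍ := ⟨(Real.exp t : ℂ) * Complex.I, by
  rw [Complex.im_ofReal_mul]
  simpa using Real.exp_pos t⟩

/-- The positive `y`-axis. -/
def yAxis : Set ℍ := {z | z.re = 0}

/-- The geodesic `σ 𝓛` of `ℍ`, with `𝓛` the positive `y`-axis; it is the axis of `γ`. -/
def Scaling.axis {γ : PSL(2, ℝ)} (S : Scaling γ) : Set ℍ := (fun z : ℍ => S.σ • z) '' yAxis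

/-- The parametrization `t ↦ σ (e^t i)` of the axis of `γ`. Composed with the projection to `M` and
restricted to `[0, ℓ]`, it runs once through the closed geodesic determined by `γ`. -/
def Scaling.path {γ : PSL(2, ℝ)} (S : Scaling γ) (t : ℝ) : ℍ := S.σ • expI t

/-- The hyperbolic speed `√(x'² + y'²) / y` of a path `c = x + i y` in `ℍ`. -/
def hypSpeed (c : ℝ → ℍ) (t : ℝ) : ℝ := ‖deriv (fun u => (c u : ℂ)) t‖ / (c t).im

/-- The integrand `f ds_hyp` of the integral of a function on `M` along the projection of a path
in `ℍ`. -/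
def lineIntegrand (Γ : Subgroup PSL(2, ℝ)) (f : Surface Γ → ℂ) (c : ℝ → ℍ) (t : ℝ) : ℂ :=
  f (proj Γ (c t)) * (hypSpeed c t : ℂ)

/-- The integral `∫ f ds_hyp` over the closed geodesic determined by `γ`. -/
def closedGeodesicIntegral (Γ : Subgroup PSL(2, ℝ)) {γ : PSL(2, ℝ)} (S : Scaling γ)
    (f : Surface Γ → ℂ) : ℂ :=
  ∫ t in (0 : ℝ)..S.ℓ, lineIntegrand Γ f S.path t

/-! ### The automorphic kernel -/

/-- The term `cosh(d_hyp(z, η w))^{-s}`. -/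
def kernelTerm (Γ : Subgroup PSL(2, ℝ)) (s : ℂ) (z w : ℍ) (η : Γ) : ℂ :=
  (Real.cosh (dist z (η • w)) : ℂ) ^ (-s)

lemma kernel_wd (Γ : Subgroup PSL(2, ℝ)) (s : ℂ) (z w : ℍ) (g h : Γ) :
    ∑' η, kernelTerm Γ s (g • z) (h • w) η = ∑' η, kernelTerm Γ s z w η := by
  rw [← Equiv.tsum_eq ((Equiv.mulLeft g).trans (Equiv.mulRight h⁻¹))]
  refine tsum_congr fun η => ?_
  have : ((Equiv.mulLeft g).trans (Equiv.mulRight h⁻¹)) η = g * η * h⁻¹ := rfl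
  rw [kernelTerm, this, smul_smul, inv_mul_cancel_right, mul_smul, kernelTerm]
  have hd : dist (g • z) (g • (η • w)) = dist z (η • w) := dist_smul (g : PSL(2, ℝ)) z (η • w)
  rw [hd]

/-- The automorphic kernel `K_s(z, w) = ∑_{η ∈ Γ} cosh(d_hyp(z, η w))^{-s}` on `M × M`. -/
def kernel (Γ : Subgroup PSL(2, ℝ)) (s : ℂ) : Surface Γ → Surface Γ → ℂ :=
  Quotient.lift₂ (fun z w : ℍ => ∑' η, kernelTerm Γ s z w η) (by
    rintro _ _ z w ⟨g, rfl⟩ ⟨h, rfl⟩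
    exact kernel_wd Γ s z w g h)

/-! ### The hyperbolic Eisenstein series -/

lemma diagExp_smul_mem {ℓ : ℝ} {z : ℍ} (hz : z ∈ yAxis) : diagExp ℓ • z ∈ yAxis := by
  have hz' : (z : ℂ).re = 0 := hz
  change ((diagExp ℓ • z : ℍ) : ℂ).re = 0
  rw [UpperHalfPlane.coe_specialLinearGroup_apply]
  have e : (((Real.exp (ℓ / 2) : ℝ) : ℂ) * z) / ((Real.exp (-ℓ / 2) : ℝ) : ℂ)
      = ((Real.exp (ℓ / 2) / Real.exp (-ℓ / 2) : ℝ) : ℂ) * z := by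
    push_cast; ring
  simp only [diagExp, Matrix.of_apply, Matrix.cons_val', Matrix.cons_val_zero,
    Matrix.cons_val_one, Matrix.cons_val_fin_one, Algebra.algebraMap_self, RingHom.id_apply,
    Complex.ofReal_zero, add_zero, zero_mul, zero_add]
  rw [e, Complex.re_ofReal_mul, hz', mul_zero]

lemma diagExp_neg (ℓ : ℝ) : diagExp (-ℓ) = (diagExp ℓ)⁻¹ := by
  rw [Matrix.SpecialLinearGroup.SL2_inv_expl]
  ext i j
  fin_cases i <;> fin_cases j <;> simp [diagExp]

lemma Scaling.smul_mem_axis {γ : PSL(2, ℝ)} (S : Scaling γ) {z : ℍ} (hz : z ∈ S.axis) :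
    γ • z ∈ S.axis ∧ γ⁻¹ • z ∈ S.axis := by
  obtain ⟨w, hw, rfl⟩ := hz
  have h1 : γ = S.σ * (QuotientGroup.mk (diagExp S.ℓ) : PSL(2, ℝ)) * S.σ⁻¹ := by
    rw [← S.conj_eq]; group
  have h2 : γ⁻¹ = S.σ * (QuotientGroup.mk (diagExp (-S.ℓ)) : PSL(2, ℝ)) * S.σ⁻¹ := by
    rw [diagExp_neg, QuotientGroup.mk_inv, ← S.conj_eq]; group
  refine ⟨⟨diagExp S.ℓ • w, diagExp_smul_mem hw, ?_⟩,
    ⟨diagExp (-S.ℓ) • w, diagExp_smul_mem hw, ?_⟩⟩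
  · have h3 : γ * S.σ = S.σ * (QuotientGroup.mk (diagExp S.ℓ) : PSL(2, ℝ)) :=
      eq_mul_inv_iff_mul_eq.mp h1
    change S.σ • (diagExp S.ℓ • w) = γ • (S.σ • w)
    rw [← mk_smul, ← mul_smul, ← mul_smul, h3]
  · have h3 : γ⁻¹ * S.σ = S.σ * (QuotientGroup.mk (diagExp (-S.ℓ)) : PSL(2, ℝ)) :=
      eq_mul_inv_iff_mul_eq.mp h2
    change S.σ • (diagExp (-S.ℓ) • w) = γ⁻¹ • (S.σ • w)
    rw [← mk_smul, ← mul_smul, ← mul_smul, h3]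

lemma Scaling.image_axis {γ : PSL(2, ℝ)} (S : Scaling γ) :
    (fun z : ℍ => γ • z) '' S.axis = S.axis := by
  ext z
  refine ⟨?_, fun hz => ⟨γ⁻¹ • z, (S.smul_mem_axis hz).2, smul_inv_smul γ z⟩⟩
  rintro ⟨w, hw, rfl⟩
  exact (S.smul_mem_axis hw).1

lemma Scaling.infDist_zpow {γ : PSL(2, ℝ)} (S : Scaling γ) (g : PSL(2, ℝ))
    (hg : g ∈ Subgroup.zpowers γ) (z : ℍ) :
    Metric.infDist (g • z) S.axis = Metric.infDist z S.axis := by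
  have base : ∀ x : ℍ, Metric.infDist (γ • x) S.axis = Metric.infDist x S.axis := fun x => by
    conv_lhs => rw [← S.image_axis]
    exact Metric.infDist_image (isometry_smul ℍ γ)
  obtain ⟨n, rfl⟩ := hg
  change Metric.infDist (γ ^ n • z) S.axis = _
  induction n generalizing z with
  | zero => rw [zpow_zero, one_smul]
  | succ n ih => rw [zpow_add_one, mul_smul, ih, base]
  | pred n ih => rw [zpow_sub_one, mul_smul, ih, ← base (γ⁻¹ • z), smul_inv_smul]

/-- The subgroup `Γ_γ = ⟨γ⟩` of `Γ`. -/
abbrev stab {Γ : Subgroup PSL(2, ℝ)} (γ : Γ) : Subgroup Γ := Subgroup.zpowers γ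

/-- The coset space `Γ_γ \ Γ`, consisting of the cosets `Γ_γ η`. -/
abbrev Cosets {Γ : Subgroup PSL(2, ℝ)} (γ : Γ) : Type := Quotient (QuotientGroup.rightRel (stab γ))

/-- The term `cosh(d_hyp(η z, 𝓛_γ))^{-s}` as a function of the coset `Γ_γ η`. -/
def eisTerm {Γ : Subgroup PSL(2, ℝ)} {γ : Γ} (S : Scaling (γ : PSL(2, ℝ))) (s : ℂ) (z : ℍ) :
    Cosets γ → ℂ :=
  Quotient.lift (fun η : Γ => (Real.cosh (Metric.infDist (η • z) S.axis) : ℂ) ^ (-s)) (by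
    intro a b hab
    obtain ⟨n, hn⟩ := QuotientGroup.rightRel_apply.mp hab
    have hb : b = γ ^ n * a := by
      change γ ^ n = b * a⁻¹ at hn
      rw [hn]; group
    have h := S.infDist_zpow ((γ : PSL(2, ℝ)) ^ n) ⟨n, rfl⟩ (a • z)
    have e : b • z = ((γ : PSL(2, ℝ)) ^ n) • (a • z) := by
      rw [hb, mul_smul]; rfl
    simp only [e, h])

lemma eis_wd {Γ : Subgroup PSL(2, ℝ)} {γ : Γ} (S : Scaling (γ : PSL(2, ℝ))) (s : ℂ) (z : ℍ)
    (g : Γ) : ∑' η, eisTerm S s (g • z) η = ∑' η, eisTerm S s z η := by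
  have hr : ∀ a b : Γ, QuotientGroup.rightRel (stab γ) a b ↔
      QuotientGroup.rightRel (stab γ) (Equiv.mulRight g a) (Equiv.mulRight g b) := by
    intro a b
    rw [QuotientGroup.rightRel_apply, QuotientGroup.rightRel_apply]
    simp
  rw [← Equiv.tsum_eq (Quotient.congr (Equiv.mulRight g) hr) (eisTerm S s z)]
  refine tsum_congr fun η => ?_
  induction η using Quotient.inductionOn with
  | h a =>
    change (Real.cosh (Metric.infDist (a • g • z) S.axis) : ℂ) ^ (-s) =
      (Real.cosh (Metric.infDist ((a * g) • z) S.axis) : ℂ) ^ (-s)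
    rw [mul_smul]

/-- The hyperbolic Eisenstein series `∑_{η ∈ Γ_γ \ Γ} cosh(d_hyp(η z, 𝓛_γ))^{-s}` on `M`. -/
def eisenstein {Γ : Subgroup PSL(2, ℝ)} {γ : Γ} (S : Scaling (γ : PSL(2, ℝ))) (s : ℂ) :
    Surface Γ → ℂ :=
  Quotient.lift (fun z : ℍ => ∑' η, eisTerm S s z η) (by
    rintro _ z ⟨g, rfl⟩
    exact eis_wd S s z g)

/-! ### Every hyperbolic element has a scaling matrix -/

lemma Scaling.of_mul {A σ : SL(2, ℝ)} {ℓ : ℝ} (h : 0 < ℓ) (e : A.1 * σ.1 = σ.1 * (diagExp ℓ).1) :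
    Nonempty (Scaling (QuotientGroup.mk A : PSL(2, ℝ))) := by
  refine ⟨⟨QuotientGroup.mk σ, ℓ, h, ?_⟩⟩
  rw [← QuotientGroup.mk_inv, ← QuotientGroup.mk_mul, ← QuotientGroup.mk_mul, mul_assoc,
    show A * σ = σ * diagExp ℓ from Subtype.ext e, inv_mul_cancel_left]

lemma exists_scaling_aux (A : SL(2, ℝ)) (hA : 2 < A 0 0 + A 1 1) :
    Nonempty (Scaling (QuotientGroup.mk A : PSL(2, ℝ))) := by
  induction A using Matrix.SpecialLinearGroup.fin_two_induction with
  | _ a b c d hdet =>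
  replace hA : 2 < a + d := by simpa using hA
  obtain ⟨l, hl, hsum⟩ : ∃ l : ℝ, 1 < l ∧ l + l⁻¹ = a + d := by
    have h4 : 0 < (a + d) ^ 2 - 4 := by nlinarith
    have hs := Real.sq_sqrt h4.le
    have hs0 := Real.sqrt_pos.mpr h4
    set r := √((a + d) ^ 2 - 4)
    refine ⟨(a + d + r) / 2, by linarith, ?_⟩
    have hne : a + d + r ≠ 0 := by linarith
    field_simp
    nlinarith
  have hl0 : l ≠ 0 := by linarith
  have hlinv : l⁻¹ < 1 := inv_lt_one_of_one_lt₀ hl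
  have hm : l * l⁻¹ = 1 := mul_inv_cancel₀ hl0
  have he1 : Real.exp (2 * Real.log l / 2) = l := by
    rw [mul_div_cancel_left₀ _ (two_ne_zero), Real.exp_log (by linarith)]
  have he2 : Real.exp (-(2 * Real.log l) / 2) = l⁻¹ := by
    rw [neg_div, Real.exp_neg, he1]
  have hpos : 0 < 2 * Real.log l := by have := Real.log_pos hl; linarith
  generalize l⁻¹ = m at *
  by_cases hc : c = 0
  · subst hc
    have hfac : (a - l) * (a - m) = 0 := by
      have hd : d = l + m - a := by linarith
      subst hd
      linear_combination hm - hdet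
    rcases mul_eq_zero.mp hfac with h | h
    · have ha : a = l := by linarith
      have hd : d = m := by linarith
      have hne : m - l ≠ 0 := by linarith
      refine Scaling.of_mul (σ := ⟨!![1, b / (m - l); 0, 1], by simp⟩) hpos ?_
      simp only [diagExp, Matrix.mul_fin_two, he1, he2, ha, hd]
      ext i j
      fin_cases i <;> fin_cases j <;> simp
      field_simp
      ring
    · have ha : a = m := by linarith
      have hd : d = l := by linarith
      have hne : l - m ≠ 0 := by linarith
      refine Scaling.of_mul (σ := ⟨!![b / (l - m), -1; 1, 0], by simp⟩) hpos ?_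
      simp only [diagExp, Matrix.mul_fin_two, he1, he2, ha, hd]
      ext i j
      fin_cases i <;> fin_cases j <;> simp
      field_simp
      ring
  · have hne : l - m ≠ 0 := by linarith
    refine Scaling.of_mul
      (σ := ⟨!![(l - d) / (c * (l - m)), m - d; 1 / (l - m), c], by
        rw [Matrix.det_fin_two_of]; field_simp; ring⟩) hpos ?_
    simp only [diagExp, Matrix.mul_fin_two, he1, he2]
    have ha : a = l + m - d := by linarith
    subst ha
    have hb : b * c = (l + m - d) * d - l * m := by linarith
    ext i j
    fin_cases i <;> fin_cases j <;> simp
    · field_simp; linear_combination hb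
    · linear_combination hb
    · field_simp; ring
    · ring

/-- Every hyperbolic element of `PSL(2, ℝ)` has a scaling matrix. -/
theorem IsHyperbolic.nonempty_scaling {g : PSL(2, ℝ)} (hg : IsHyperbolic g) :
    Nonempty (Scaling g) := by
  obtain ⟨A, rfl, hA⟩ := hg
  have hA' : 0 < (A 0 0 + A 1 1) ^ 2 - 4 := by
    have := hA
    rw [Matrix.IsHyperbolic, Matrix.discr_fin_two, Matrix.SpecialLinearGroup.det_coe,
      Matrix.trace_fin_two] at this
    simpa using this
  rcases le_or_gt 0 (A 0 0 + A 1 1) with h | h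
  · exact exists_scaling_aux A (by nlinarith)
  · have h2 : (QuotientGroup.mk A : PSL(2, ℝ)) = QuotientGroup.mk (-A) := by
      rw [QuotientGroup.eq]
      have : A⁻¹ * -A = -1 := by simp
      rw [this]
      exact Subgroup.mem_center_iff.mpr fun B => by simp
    rw [h2]
    refine exists_scaling_aux (-A) ?_
    simp
    nlinarith

end HypEis

end

open HypEis

/-!
Every element of `Γ` is uniquely of the form `a⁻¹ γ ^ n`, with `a` running through representatives
of `Γ_γ \ Γ`. The translates by `γ ^ n` of the segment parametrized by `[0, ℓ]` tile the axis, so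
integrating the terms of `K_s` in one coset over the closed geodesic amounts to integrating
`cosh (d (a z, ·)) ^ (-s)` over the whole axis. By the hyperbolic theorem of Pythagoras,
`cosh (d (z, σ e^t i)) = cosh (d (z, 𝓛_γ)) * cosh (t - t₀)`, where `t₀` is the parameter of the foot
of the perpendicular from `z`; each such integral is therefore a term of the Eisenstein series
times `∫ cosh t ^ (-s) dt`, which the sigmoid substitution turns into a Beta integral.

Convergence comes from comparing the sum of `cosh (d (z, η w)) ^ (-σ)` over `Γ` with the integral of
this function over `ℍ`: since `Γ` is discrete, the translates of a ball overlap with bounded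
multiplicity. Discreteness also makes the translations along the axis that belong to `Γ` a cyclic
group, which contains the centralizer of `γ`.
-/

namespace HypEis

/-! ### The integral of a power of the hyperbolic cosine -/

lemma hasDerivWithinAt_sigmoid (t : ℝ) :
    HasDerivWithinAt Real.sigmoid (Real.sigmoid t * (1 - Real.sigmoid t)) Set.univ t :=
  (Real.hasDerivAt_sigmoid t).hasDerivWithinAt

lemma abs_deriv_sigmoid_smul_betaIntegrand (u v : ℂ) (t : ℝ) :
    |Real.sigmoid t * (1 - Real.sigmoid t)| •
        ((Real.sigmoid t : ℂ) ^ (u - 1) * (1 - (Real.sigmoid t : ℂ)) ^ (v - 1)) =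
      (Real.sigmoid t : ℂ) ^ u * (1 - (Real.sigmoid t : ℂ)) ^ v := by
  have hx : 0 < Real.sigmoid t := Real.sigmoid_pos t
  have hy : 0 < 1 - Real.sigmoid t := sub_pos.2 (Real.sigmoid_lt_one t)
  have hx0 : (Real.sigmoid t : ℂ) ≠ 0 := mod_cast hx.ne'
  have hy0 : 1 - (Real.sigmoid t : ℂ) ≠ 0 := mod_cast hy.ne'
  rw [abs_of_pos (mul_pos hx hy), Complex.real_smul, Complex.cpow_sub _ _ hx0,
    Complex.cpow_sub _ _ hy0, Complex.cpow_one, Complex.cpow_one]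
  push_cast
  field_simp

lemma integrable_sigmoid_cpow {u v : ℂ} (hu : 0 < u.re) (hv : 0 < v.re) :
    Integrable fun t : ℝ => (Real.sigmoid t : ℂ) ^ u * (1 - (Real.sigmoid t : ℂ)) ^ v := by
  have h := Complex.betaIntegral_convergent hu hv
  rw [intervalIntegrable_iff_integrableOn_Ioo_of_le zero_le_one, ← Real.range_sigmoid,
    ← Set.image_univ, integrableOn_image_iff_integrableOn_abs_deriv_smul MeasurableSet.univ
      (fun t _ => hasDerivWithinAt_sigmoid t) Real.sigmoid_injective.injOn] at h
  simpa only [abs_deriv_sigmoid_smul_betaIntegrand, integrableOn_univ] using h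

lemma integral_sigmoid_cpow (u v : ℂ) :
    ∫ t : ℝ, (Real.sigmoid t : ℂ) ^ u * (1 - (Real.sigmoid t : ℂ)) ^ v =
      Complex.betaIntegral u v := by
  rw [Complex.betaIntegral, intervalIntegral.integral_of_le zero_le_one,
    integral_Ioc_eq_integral_Ioo, ← Real.range_sigmoid, ← Set.image_univ,
    integral_image_eq_integral_abs_deriv_smul MeasurableSet.univ
      (fun t _ => hasDerivWithinAt_sigmoid t) Real.sigmoid_injective.injOn]
  simp only [abs_deriv_sigmoid_smul_betaIntegrand, Measure.restrict_univ]

lemma sigmoid_two_mul (t : ℝ) : Real.sigmoid (2 * t) = Real.exp t / (2 * Real.cosh t) := by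
  rw [Real.sigmoid_def, Real.cosh_eq, show -(2 * t) = -t - t by ring, Real.exp_sub]
  field_simp

lemma sigmoid_two_mul_mul_one_sub (t : ℝ) :
    Real.sigmoid (2 * t) * (1 - Real.sigmoid (2 * t)) =
      (2 * Real.cosh t)⁻¹ * (2 * Real.cosh t)⁻¹ := by
  rw [← Real.sigmoid_neg, ← mul_neg, sigmoid_two_mul, sigmoid_two_mul, Real.cosh_neg,
    div_mul_div_comm, ← Real.exp_add, add_neg_cancel, Real.exp_zero, one_div, mul_inv]

lemma cosh_cpow_neg_eq_sigmoid_cpow (s : ℂ) (t : ℝ) :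
    (Real.cosh t : ℂ) ^ (-s) = 2 ^ s *
      ((Real.sigmoid (2 * t) : ℂ) ^ (s / 2) * (1 - (Real.sigmoid (2 * t) : ℂ)) ^ (s / 2)) := by
  have hc : 0 < Real.cosh t := Real.cosh_pos t
  have hsig : (Real.sigmoid (2 * t) : ℂ) ^ (s / 2) * (1 - (Real.sigmoid (2 * t) : ℂ)) ^ (s / 2) =
      (((2 * Real.cosh t)⁻¹ : ℝ) : ℂ) ^ s := by
    rw [← Complex.ofReal_one, ← Complex.ofReal_sub, ← Complex.mul_cpow_ofReal_nonneg
      (Real.sigmoid_nonneg _) (sub_nonneg.2 (Real.sigmoid_le_one _)), ← Complex.ofReal_mul,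
      sigmoid_two_mul_mul_one_sub, Complex.ofReal_mul,
      Complex.mul_cpow_ofReal_nonneg (by positivity) (by positivity),
      ← Complex.cpow_add _ _ (mod_cast (by positivity)), add_halves]
  have harg : Complex.arg (Real.cosh t : ℂ) ≠ Real.pi := by
    rw [Complex.arg_ofReal_of_nonneg hc.le]
    exact Real.pi_ne_zero.symm
  rw [hsig, ← Complex.ofReal_ofNat, ← Complex.mul_cpow_ofReal_nonneg zero_le_two (by positivity),
    ← Complex.ofReal_mul, mul_inv, mul_inv_cancel_left₀ two_ne_zero, Complex.ofReal_inv,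
    Complex.inv_cpow _ _ harg, Complex.cpow_neg]

lemma integrable_cosh_cpow_neg {s : ℂ} (hs : 0 < s.re) :
    Integrable fun t : ℝ => (Real.cosh t : ℂ) ^ (-s) := by
  have hs2 : 0 < (s / 2).re := by simpa using hs
  simp only [cosh_cpow_neg_eq_sigmoid_cpow]
  exact ((integrable_sigmoid_cpow hs2 hs2).comp_mul_left' two_ne_zero).const_mul _

lemma integral_cosh_cpow_neg {s : ℂ} (hs : 0 < s.re) :
    ∫ t : ℝ, (Real.cosh t : ℂ) ^ (-s) =
      2 ^ (s - 1) * Complex.Gamma (s / 2) ^ 2 / Complex.Gamma s := by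
  have hs2 : 0 < (s / 2).re := by simpa using hs
  have hbeta : Complex.Gamma (s / 2) ^ 2 =
      Complex.Gamma s * Complex.betaIntegral (s / 2) (s / 2) := by
    rw [sq, Complex.Gamma_mul_Gamma_eq_betaIntegral hs2 hs2, add_halves]
  simp only [cosh_cpow_neg_eq_sigmoid_cpow, integral_const_mul]
  rw [Measure.integral_comp_mul_left (fun t : ℝ => (Real.sigmoid t : ℂ) ^ (s / 2) *
      (1 - (Real.sigmoid t : ℂ)) ^ (s / 2)), integral_sigmoid_cpow, hbeta,
    Complex.cpow_sub _ _ two_ne_zero, Complex.cpow_one]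
  have hΓ : Complex.Gamma s ≠ 0 := Complex.Gamma_ne_zero_of_re_pos hs
  simp only [abs_inv, Nat.abs_ofNat, Complex.real_smul, Complex.ofReal_inv, Complex.ofReal_ofNat]
  field_simp

lemma integral_cosh_cpow_neg_ne_zero {s : ℂ} (hs : 0 < s.re) :
    ∫ t : ℝ, (Real.cosh t : ℂ) ^ (-s) ≠ 0 := by
  have hs2 : 0 < (s / 2).re := by simpa using hs
  rw [integral_cosh_cpow_neg hs]
  exact div_ne_zero (mul_ne_zero (by simp [Complex.cpow_eq_zero_iff])
    (pow_ne_zero _ (Complex.Gamma_ne_zero_of_re_pos hs2))) (Complex.Gamma_ne_zero_of_re_pos hs)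

/-! ### Geometry of the axis -/

lemma coe_expI (t : ℝ) : (expI t : ℂ) = (Real.exp t : ℂ) * Complex.I := rfl

lemma expI_re (t : ℝ) : (expI t).re = 0 := by
  rw [← coe_re, coe_expI, Complex.re_ofReal_mul, Complex.I_re, mul_zero]

lemma expI_im (t : ℝ) : (expI t).im = Real.exp t := by
  rw [← coe_im, coe_expI, Complex.im_ofReal_mul, Complex.I_im, mul_one]

lemma isometry_expI : Isometry expI :=
  Isometry.of_dist_eq fun t u => by
    rw [dist_of_re_eq (by rw [expI_re, expI_re]), expI_im, expI_im, Real.log_exp, Real.log_exp]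

lemma range_expI : Set.range expI = yAxis := by
  refine Set.Subset.antisymm (Set.range_subset_iff.2 expI_re) fun z hz => ?_
  refine ⟨Real.log z.im, ext_re_im ?_ ?_⟩
  · rw [expI_re, hz]
  · rw [expI_im, Real.exp_log z.im_pos]

lemma cosh_dist_expI (z : ℍ) (t : ℝ) :
    Real.cosh (dist z (expI t)) = ‖(z : ℂ)‖ / z.im * Real.cosh (t - Real.log ‖(z : ℂ)‖) := by
  have hz : 0 < ‖(z : ℂ)‖ := norm_pos_iff.2 z.ne_zero
  have hsq : ‖(z : ℂ)‖ ^ 2 = z.re ^ 2 + z.im ^ 2 := by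
    rw [← Complex.normSq_eq_norm_sq, Complex.normSq_apply, coe_re, coe_im, sq, sq]
  have him : z.im ≠ 0 := z.im_ne_zero
  rw [cosh_dist', expI_re, expI_im, Real.cosh_eq, neg_sub, Real.exp_sub, Real.exp_sub,
    Real.exp_log hz]
  field_simp
  rw [hsq]
  ring

lemma cosh_infDist_yAxis (z : ℍ) : Real.cosh (Metric.infDist z yAxis) = ‖(z : ℂ)‖ / z.im := by
  have hfoot : Real.cosh (dist z (expI (Real.log ‖(z : ℂ)‖))) = ‖(z : ℂ)‖ / z.im := by
    rw [cosh_dist_expI, sub_self, Real.cosh_zero, mul_one]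
  rw [← hfoot, ← range_expI]
  congr 1
  refine le_antisymm (Metric.infDist_le_dist_of_mem ⟨_, rfl⟩)
    ((Metric.le_infDist (Set.range_nonempty _)).2 ?_)
  rintro _ ⟨t, rfl⟩
  rw [← abs_of_nonneg (dist_nonneg (x := z)), ← abs_of_nonneg (dist_nonneg (x := z) (y := expI t)),
    ← Real.cosh_le_cosh, hfoot, cosh_dist_expI]
  exact le_mul_of_one_le_right (by positivity) (Real.one_le_cosh _)

lemma differentiable_coe_expI : Differentiable ℝ fun t => (expI t : ℂ) := by
  simp only [coe_expI]
  fun_prop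

lemma hypSpeed_expI (t : ℝ) : hypSpeed expI t = 1 := by
  have hderiv : HasDerivAt (fun u => (expI u : ℂ)) (expI t) t :=
    (Real.hasDerivAt_exp t).ofReal_comp.mul_const _
  rw [hypSpeed, hderiv.deriv, expI_im, coe_expI, norm_mul, Complex.norm_I, mul_one,
    Complex.norm_real, Real.norm_of_nonneg (Real.exp_pos t).le, div_self (Real.exp_pos t).ne']

lemma hypSpeed_smul (g : PSL(2, ℝ)) {c : ℝ → ℍ} {t : ℝ}
    (hc : DifferentiableAt ℝ (fun u => (c u : ℂ)) t) :
    hypSpeed (fun u => g • c u) t = hypSpeed c t := by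
  induction g using QuotientGroup.induction_on with
  | H A =>
    set G : GL (Fin 2) ℝ := Matrix.SpecialLinearGroup.mapGL ℝ A
    have hdet : G.val.det = 1 := by simp [G]
    have hsmul (z : ℍ) : (A : PSL(2, ℝ)) • z = G • z := rfl
    have hderiv := (hasStrictDerivAt_smul (hdet ▸ one_pos) (c t)).hasDerivAt.comp_of_eq t
      hc.hasDerivAt rfl
    have hcoe : (fun u => (((A : PSL(2, ℝ)) • c u : ℍ) : ℂ)) =
        (fun z => ((G • ofComplex z : ℍ) : ℂ)) ∘ fun u => (c u : ℂ) := by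
      funext u
      rw [Function.comp_apply, ofComplex_apply, hsmul]
    have hden : 0 < ‖denom G (c t)‖ := norm_pos_iff.2 (denom_ne_zero _ _)
    rw [hypSpeed, hypSpeed, hcoe, hderiv.deriv, hsmul, im_smul_eq_div_normSq,
      Matrix.GeneralLinearGroup.val_det_apply, hdet, Complex.normSq_eq_norm_sq, norm_mul, norm_div,
      norm_pow, Complex.ofReal_one, norm_one, abs_one]
    field_simp

namespace Scaling

variable {γ : PSL(2, ℝ)} (S : Scaling γ)

/-- The parameter `t` for which `S.path t` is the orthogonal projection of `z` to the axis. -/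
noncomputable def foot (z : ℍ) : ℝ := Real.log ‖((S.σ⁻¹ • z : ℍ) : ℂ)‖

lemma cosh_dist_path (z : ℍ) (t : ℝ) :
    Real.cosh (dist z (S.path t)) =
      Real.cosh (Metric.infDist z S.axis) * Real.cosh (t - S.foot z) := by
  obtain ⟨w, rfl⟩ : ∃ w, S.σ • w = z := ⟨S.σ⁻¹ • z, smul_inv_smul _ _⟩
  rw [path, dist_smul, axis, Metric.infDist_image (isometry_smul ℍ S.σ), cosh_dist_expI,
    cosh_infDist_yAxis, foot, inv_smul_smul]

lemma isometry_path : Isometry S.path := (isometry_smul ℍ S.σ).comp isometry_expI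

lemma hypSpeed_path (t : ℝ) : hypSpeed S.path t = 1 :=
  (hypSpeed_smul S.σ (differentiable_coe_expI t)).trans (hypSpeed_expI t)

end Scaling

lemma diagExp_smul_expI (ℓ t : ℝ) : diagExp ℓ • expI t = expI (t + ℓ) := by
  have hexp : Real.exp (t + ℓ) = Real.exp (ℓ / 2) * Real.exp t / Real.exp (-ℓ / 2) := by
    rw [← Real.exp_add, ← Real.exp_sub]
    congr 1
    ring
  apply UpperHalfPlane.ext
  rw [coe_specialLinearGroup_apply, coe_expI, coe_expI, hexp]
  simp only [diagExp, Algebra.algebraMap_self, Real.ringHom_apply, Matrix.of_apply,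
    Matrix.cons_val', Matrix.cons_val_zero, Matrix.cons_val_one, Matrix.cons_val_fin_one,
    Complex.ofReal_zero, Complex.ofReal_div, Complex.ofReal_mul, add_zero, zero_mul, zero_add]
  ring

lemma diagExp_zero : diagExp 0 = 1 := by
  ext i j
  fin_cases i <;> fin_cases j <;> simp [diagExp]

lemma diagExp_add (t u : ℝ) : diagExp (t + u) = diagExp t * diagExp u := by
  apply Subtype.ext
  rw [Matrix.SpecialLinearGroup.coe_mul, diagExp, diagExp, diagExp, Matrix.mul_fin_two]
  simp only [mul_zero, zero_mul, add_zero, zero_add, ← Real.exp_add, ← add_div, neg_add]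

namespace Scaling

variable {γ : PSL(2, ℝ)} (S : Scaling γ)

/-- The one-parameter group of hyperbolic translations along the axis of `γ`, parametrized by the
signed length of the translation. -/
noncomputable def translation : Multiplicative ℝ →* PSL(2, ℝ) where
  toFun t := S.σ * (diagExp t.toAdd : PSL(2, ℝ)) * S.σ⁻¹
  map_one' := by rw [toAdd_one, diagExp_zero, QuotientGroup.mk_one, mul_one, mul_inv_cancel]
  map_mul' t u := by rw [toAdd_mul, diagExp_add, QuotientGroup.mk_mul]; group

lemma translation_apply (t : Multiplicative ℝ) :
    S.translation t = S.σ * (diagExp t.toAdd : PSL(2, ℝ)) * S.σ⁻¹ := rfl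

lemma translation_smul_path (t : Multiplicative ℝ) (u : ℝ) :
    S.translation t • S.path u = S.path (u + t.toAdd) := by
  rw [translation_apply, path, mul_smul, inv_smul_smul, mul_smul, mk_smul, diagExp_smul_expI, path]

lemma translation_length : S.translation (Multiplicative.ofAdd S.ℓ) = γ := by
  rw [translation_apply, toAdd_ofAdd, ← S.conj_eq]
  group

lemma translation_injective : Function.Injective S.translation := fun t u htu => by
  have hpath : S.path (0 + t.toAdd) = S.path (0 + u.toAdd) := by
    rw [← translation_smul_path, htu, translation_smul_path]
  exact Multiplicative.toAdd.injective (add_left_cancel (S.isometry_path.injective hpath))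

lemma translation_int_mul_length (n : ℤ) :
    S.translation (Multiplicative.ofAdd (n * S.ℓ)) = γ ^ n := by
  rw [← zsmul_eq_mul, ofAdd_zsmul, map_zpow, translation_length]

lemma zpow_smul_path (n : ℤ) (t : ℝ) : γ ^ n • S.path t = S.path (t + n * S.ℓ) := by
  rw [← translation_int_mul_length, translation_smul_path, toAdd_ofAdd]

include S in
lemma zpow_injective : Function.Injective fun n : ℤ => γ ^ n := fun m n hmn => by
  simp only [← S.translation_int_mul_length] at hmn
  have hmul := Multiplicative.ofAdd.injective (S.translation_injective hmn)
  exact Int.cast_injective (mul_right_cancel₀ S.ℓ_pos.ne' hmul)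

end Scaling

/-! ### Discrete groups act properly discontinuously -/

instance (Γ : Subgroup PSL(2, ℝ)) : IsIsometricSMul Γ ℍ :=
  ⟨fun g => isometry_smul ℍ (g : PSL(2, ℝ))⟩

instance : IsClosed (Subgroup.center SL(2, ℝ) : Set SL(2, ℝ)) := by
  rw [← Subgroup.centralizer_univ]
  exact Set.isClosed_centralizer _

instance : T2Space PSL(2, ℝ) :=
  have : T3Space PSL(2, ℝ) := QuotientGroup.instT3Space (Subgroup.center SL(2, ℝ))
  inferInstance

instance : SecondCountableTopology SL(2, ℝ) :=
  have : SecondCountableTopology (Matrix (Fin 2) (Fin 2) ℝ) :=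
    inferInstanceAs (SecondCountableTopology (Fin 2 → Fin 2 → ℝ))
  Matrix.SpecialLinearGroup.isClosedEmbedding_val.isEmbedding.secondCountableTopology

instance : ContinuousSMul PSL(2, ℝ) ℍ where
  continuous_smul := by
    have hq : IsOpenQuotientMap (Prod.map QuotientGroup.mk id : SL(2, ℝ) × ℍ → PSL(2, ℝ) × ℍ) :=
      QuotientGroup.isOpenQuotientMap_mk.prodMap .id
    exact hq.isQuotientMap.continuous_iff.2 (continuous_smul (M := SL(2, ℝ)) (X := ℍ))

instance : MulAction.IsPretransitive PSL(2, ℝ) ℍ where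
  exists_smul_eq z w :=
    let ⟨A, hA⟩ := MulAction.exists_smul_eq SL(2, ℝ) z w
    ⟨A, hA⟩

instance : ProperSMul PSL(2, ℝ) ℍ :=
  MulAction.properSMul_of_proper_orbitMap (x := I) <|
    isProperMap_of_comp_of_surj QuotientGroup.continuous_mk (continuous_id.smul continuous_const)
      isProperMap_smul_I
      QuotientGroup.mk_surjective

section Discrete

variable (Γ : Subgroup PSL(2, ℝ)) [DiscreteTopology Γ]

instance : ProperlyDiscontinuousSMul Γ ℍ := by
  have : IsClosed (Γ : Set PSL(2, ℝ)) := Subgroup.isClosed_of_discrete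
  rw [properlyDiscontinuousSMul_iff_properSMul]
  infer_instance

lemma finite_setOf_dist_smul_lt (w : ℍ) (r : ℝ) : {η : Γ | dist w (η • w) < r}.Finite := by
  refine (ProperlyDiscontinuousSMul.finite_disjoint_inter_image (Γ := Γ)
    (isCompact_singleton (x := w)) (isCompact_closedBall w r)).subset fun η hη => ?_
  refine ⟨η • w, ⟨w, rfl, rfl⟩, ?_⟩
  rw [Metric.mem_closedBall, dist_comm]
  exact hη.le

instance : Countable Γ := TopologicalSpace.separableSpace_iff_countable.1 inferInstance

end Discrete

instance : SMulInvariantMeasure PSL(2, ℝ) ℍ volume := ⟨fun g s hs => by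
  obtain ⟨A, rfl⟩ := QuotientGroup.mk_surjective g
  exact SMulInvariantMeasure.measure_preimage_smul (Matrix.SpecialLinearGroup.mapGL ℝ A) hs⟩

lemma measurable_volume_density :
    Measurable fun z : ℍ => (((1 / NNReal.mk z.im z.im_pos.le) ^ 2 : NNReal) : ENNReal) := by
  have him : Measurable fun z : ℍ => NNReal.mk z.im z.im_pos.le :=
    (continuous_im.subtype_mk _).measurable
  exact ((him.const_div 1).pow_const 2).coe_nnreal_ennreal

instance : Measure.IsOpenPosMeasure (volume : Measure ℍ) :=
  have : Measure.IsOpenPosMeasure (volume.comap UpperHalfPlane.coe : Measure ℍ) :=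
    .comap _ isOpenEmbedding_coe
  (withDensity_absolutelyContinuous' measurable_volume_density.aemeasurable <|
    .of_forall fun z => ENNReal.coe_ne_zero.2 <| pow_ne_zero 2 <| one_div_ne_zero <|
      NNReal.ne_iff.1 z.im_ne_zero).isOpenPosMeasure

/-! ### Convergence of the Poincaré series -/

section OrbitSum

variable {G X : Type*} [Group G] [PseudoMetricSpace X] [MulAction G X] [IsIsometricSMul G X]

lemma encard_setOf_mem_ball_smul_le (w u : X) (r : ℝ) :
    {g : G | u ∈ Metric.ball (g • w) r}.encard ≤ {g : G | dist w (g • w) < 2 * r}.encard := by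
  obtain hempty | ⟨g₀, hg₀⟩ := {g : G | u ∈ Metric.ball (g • w) r}.eq_empty_or_nonempty
  · rw [hempty, Set.encard_empty]
    exact zero_le
  refine Set.encard_le_encard_of_injOn (f := (g₀⁻¹ * ·)) (fun g hg => ?_)
    (mul_right_injective g₀⁻¹).injOn
  have htri := dist_triangle_left (g₀ • w) (g • w) u
  rw [Set.mem_ofPred_eq, Metric.mem_ball] at hg₀ hg
  rw [Set.mem_ofPred_eq, mul_smul, ← dist_smul g₀, smul_inv_smul]
  linarith

/-- Integrate `F` over the balls of radius `r` about the points of the orbit of `w`: they overlap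
with bounded multiplicity. -/
lemma tsum_smul_mul_measure_ball_le [Countable G] [MeasurableSpace X] [OpensMeasurableSpace X]
    (μ : Measure X) [SMulInvariantMeasure G X μ] {F : X → ENNReal} (hF : Measurable F)
    {C : ENNReal} {r : ℝ} (hC : ∀ x y, dist x y < r → F x ≤ C * F y) (w : X) :
    (∑' g : G, F (g • w)) * μ (Metric.ball w r) ≤
      C * ({g : G | dist w (g • w) < 2 * r}.encard * ∫⁻ x, F x ∂μ) := by
  have hball (g : G) : MeasurableSet (Metric.ball (g • w) r) := Metric.isOpen_ball.measurableSet
  have hterm (g : G) : F (g • w) * μ (Metric.ball w r) ≤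
      C * ∫⁻ x, (Metric.ball (g • w) r).indicator F x ∂μ := calc
    F (g • w) * μ (Metric.ball w r) = F (g • w) * μ (Metric.ball (g • w) r) := by
      rw [← SMulInvariantMeasure.measure_preimage_smul g (hball g), Metric.preimage_smul_ball,
        inv_smul_smul]
    _ = ∫⁻ _ in Metric.ball (g • w) r, F (g • w) ∂μ := (setLIntegral_const _ _).symm
    _ ≤ ∫⁻ x in Metric.ball (g • w) r, C * F x ∂μ :=
      setLIntegral_mono' (hball g) fun x hx => hC _ _ (Metric.mem_ball'.1 hx)
    _ = C * ∫⁻ x, (Metric.ball (g • w) r).indicator F x ∂μ := by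
      rw [lintegral_const_mul _ hF, lintegral_indicator (hball g)]
  have hmult (x : X) : ∑' g : G, (Metric.ball (g • w) r).indicator F x ≤
      {g : G | dist w (g • w) < 2 * r}.encard * F x := calc
    ∑' g : G, (Metric.ball (g • w) r).indicator F x
        = ∑' _ : {g : G | x ∈ Metric.ball (g • w) r}, F x := by
      rw [tsum_subtype _ fun _ => F x]
      rfl
    _ ≤ {g : G | dist w (g • w) < 2 * r}.encard * F x := by
      rw [ENNReal.tsum_set_const]
      exact mul_le_mul_left (ENat.toENNReal_mono (encard_setOf_mem_ball_smul_le w x r)) _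
  calc (∑' g : G, F (g • w)) * μ (Metric.ball w r)
      ≤ ∑' g : G, C * ∫⁻ x, (Metric.ball (g • w) r).indicator F x ∂μ := by
        rw [← ENNReal.tsum_mul_right]
        exact ENNReal.tsum_le_tsum hterm
    _ = C * ∫⁻ x, ∑' g : G, (Metric.ball (g • w) r).indicator F x ∂μ := by
        rw [ENNReal.tsum_mul_left, lintegral_tsum fun g => (hF.indicator (hball g)).aemeasurable]
    _ ≤ C * ({g : G | dist w (g • w) < 2 * r}.encard * ∫⁻ x, F x ∂μ) := by
        rw [← lintegral_const_mul _ hF]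
        gcongr with x
        exact hmult x

end OrbitSum

lemma cosh_dist_triangle {X : Type*} [PseudoMetricSpace X] (x y z : X) :
    Real.cosh (dist x z) ≤ 2 * Real.cosh (dist x y) * Real.cosh (dist y z) := by
  have hmono : Real.cosh (dist x z) ≤ Real.cosh (dist x y + dist y z) := by
    rw [Real.cosh_le_cosh, abs_of_nonneg dist_nonneg, abs_of_nonneg (by positivity)]
    exact dist_triangle x y z
  have hsub := Real.cosh_pos (dist x y - dist y z)
  rw [Real.cosh_sub] at hsub
  rw [Real.cosh_add] at hmono
  linarith

lemma cosh_dist_rpow_neg_le {X : Type*} [PseudoMetricSpace X] {σ : ℝ} (hσ : 0 ≤ σ) {r : ℝ}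
    (x : X) {y z : X} (hyz : dist y z ≤ r) :
    Real.cosh (dist x y) ^ (-σ) ≤ (2 * Real.cosh r) ^ σ * Real.cosh (dist x z) ^ (-σ) := by
  have hxy := Real.cosh_pos (dist x y)
  have hxz := Real.cosh_pos (dist x z)
  have hle : Real.cosh (dist x z) ≤ 2 * Real.cosh r * Real.cosh (dist x y) := by
    have hcosh : Real.cosh (dist y z) ≤ Real.cosh r := by
      rw [Real.cosh_le_cosh, abs_of_nonneg dist_nonneg]
      exact hyz.trans (le_abs_self r)
    nlinarith [cosh_dist_triangle x y z]
  rw [Real.rpow_neg hxy.le, Real.rpow_neg hxz.le, ← div_eq_mul_inv,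
    inv_le_iff_one_le_mul₀ (by positivity), div_mul_eq_mul_div, one_le_div (by positivity),
    ← Real.mul_rpow (by positivity) hxy.le]
  exact Real.rpow_le_rpow hxz.le hle hσ

lemma range_coe_eq_preimage :
    Set.range UpperHalfPlane.coe = Complex.measurableEquivRealProd ⁻¹' Set.univ ×ˢ Set.Ioi 0 := by
  ext z
  simp only [Set.mem_range, Set.mem_preimage, Set.mem_prod, Set.mem_univ, true_and, Set.mem_Ioi,
    Complex.measurableEquivRealProd_apply]
  exact ⟨fun ⟨u, hu⟩ => hu ▸ u.im_pos, fun hz => ⟨⟨z, hz⟩, rfl⟩⟩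

lemma lintegral_le_lintegral_mul_lintegral {F : ℍ → ENNReal} {g h : ℝ → ENNReal}
    (hg : Measurable g) (hh : Measurable h)
    (hF : ∀ u : ℍ, ENNReal.ofReal ((1 / u.im) ^ 2) * F u ≤ g u.re * h u.im) :
    ∫⁻ u, F u ≤ (∫⁻ x, g x) * ∫⁻ y in Set.Ioi 0, h y := calc
  ∫⁻ u, F u ≤ ∫⁻ u : ℍ, g (u : ℂ).re * h (u : ℂ).im ∂volume.comap UpperHalfPlane.coe := by
    refine (lintegral_withDensity_le_lintegral_mul _ measurable_volume_density F).trans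
      (lintegral_mono fun u => le_of_eq_of_le ?_ (hF u))
    rw [Pi.mul_apply]
    congr 1
    rw [ENNReal.ofReal, ENNReal.coe_inj, Real.toNNReal_of_nonneg (by positivity)]
    ext
    simp
  _ = ∫⁻ z in Set.range UpperHalfPlane.coe, g z.re * h z.im := by
    rw [← measurableEmbedding_coe.map_comap, measurableEmbedding_coe.lintegral_map]
  _ = ∫⁻ p in Set.univ ×ˢ Set.Ioi 0, g p.1 * h p.2 := by
    rw [range_coe_eq_preimage]
    exact Complex.volume_preserving_equiv_real_prod.setLIntegral_comp_preimage_emb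
      Complex.measurableEquivRealProd.measurableEmbedding (fun p : ℝ × ℝ => g p.1 * h p.2) _
  _ = (∫⁻ x, g x) * ∫⁻ y in Set.Ioi 0, h y := by
    rw [Measure.volume_eq_prod, ← Measure.prod_restrict, Measure.restrict_univ,
      lintegral_prod_mul hg.aemeasurable hh.aemeasurable]

lemma integrableOn_rpow_mul_one_add_sq_rpow_neg {a b : ℝ} (ha : 0 < a) (hab : a < 2 * b) :
    IntegrableOn (fun y : ℝ => y ^ (a - 1) * (1 + y ^ 2) ^ (-b)) (Set.Ioi 0) := by
  have hcont : Continuous fun y : ℝ => (1 + y ^ 2) ^ (-b) :=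
    .rpow_const (by fun_prop) fun y => .inl (by positivity)
  refine mellin_convergent_of_isBigO_scalar (a := 2 * b) (b := 0)
    (hcont.locallyIntegrable.locallyIntegrableOn _) ?_ hab ?_ ha
  · refine .of_bound' <| (Filter.eventually_gt_atTop 0).mono fun y hy => ?_
    have hpow : y ^ (-(2 * b)) = (y ^ 2) ^ (-b) := by
      rw [← mul_neg, Real.rpow_mul hy.le, Real.rpow_two]
    rw [hpow, Real.norm_of_nonneg (by positivity), Real.norm_of_nonneg (by positivity)]
    exact Real.rpow_le_rpow_of_nonpos (by positivity) (by linarith) (by linarith)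
  · simp only [neg_zero, Real.rpow_zero]
    exact (hcont.tendsto 0).isBigO_one ℝ |>.mono nhdsWithin_le_nhds

lemma cosh_dist_I (u : ℍ) :
    Real.cosh (dist I u) = (2 * u.im)⁻¹ * (1 + u.re ^ 2 + u.im ^ 2) := by
  rw [cosh_dist', I_re, I_im]
  field_simp
  ring

/-- The product bound comes from `1 + x² + y² ≥ √(1 + x²) √(1 + y²)`. -/
lemma sq_one_div_im_mul_cosh_dist_I_rpow_neg_le {σ : ℝ} (hσ : 0 ≤ σ) (u : ℍ) :
    (1 / u.im) ^ 2 * Real.cosh (dist I u) ^ (-σ) ≤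
      2 ^ σ * (1 + u.re ^ 2) ^ (-σ / 2) * (u.im ^ (σ - 1 - 1) * (1 + u.im ^ 2) ^ (-(σ / 2))) := by
  have hy : 0 < u.im := u.im_pos
  have hcosh : Real.cosh (dist I u) ^ (-σ) =
      2 ^ σ * u.im ^ σ * (1 + u.re ^ 2 + u.im ^ 2) ^ (-σ) := by
    rw [cosh_dist_I, Real.mul_rpow (by positivity) (by positivity), Real.inv_rpow (by positivity),
      Real.rpow_neg (by positivity), inv_inv, Real.mul_rpow (by positivity) hy.le]
  have hprod : (1 + u.re ^ 2 + u.im ^ 2) ^ (-σ) ≤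
      (1 + u.re ^ 2) ^ (-σ / 2) * (1 + u.im ^ 2) ^ (-(σ / 2)) := by
    rw [show -σ = -σ / 2 + -(σ / 2) by ring, Real.rpow_add (by positivity),
      show (-σ / 2 + -(σ / 2)) / 2 = -σ / 2 by ring]
    gcongr ?_ * ?_
    · exact Real.rpow_le_rpow_of_nonpos (by positivity) (by nlinarith) (by linarith)
    · exact Real.rpow_le_rpow_of_nonpos (by positivity) (by nlinarith) (by linarith)
  have him : u.im ^ (σ - 1 - 1) = (1 / u.im) ^ 2 * u.im ^ σ := by
    rw [Real.rpow_sub_one hy.ne', Real.rpow_sub_one hy.ne']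
    field_simp
  calc (1 / u.im) ^ 2 * Real.cosh (dist I u) ^ (-σ)
      = 2 ^ σ * u.im ^ (σ - 1 - 1) * (1 + u.re ^ 2 + u.im ^ 2) ^ (-σ) := by
        rw [hcosh, him]
        ring
    _ ≤ 2 ^ σ * u.im ^ (σ - 1 - 1) * ((1 + u.re ^ 2) ^ (-σ / 2) * (1 + u.im ^ 2) ^ (-(σ / 2))) := by
        gcongr
    _ = _ := by ring

lemma lintegral_cosh_dist_I_rpow_neg_lt_top {σ : ℝ} (hσ : 1 < σ) :
    ∫⁻ u : ℍ, ENNReal.ofReal (Real.cosh (dist I u) ^ (-σ)) < ⊤ := by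
  have hre : Integrable fun x : ℝ => 2 ^ σ * (1 + x ^ 2) ^ (-σ / 2) := by
    have := integrable_rpow_neg_one_add_norm_sq (E := ℝ) (μ := volume) (r := σ) (by simpa using hσ)
    simp only [Real.norm_eq_abs, sq_abs] at this
    exact this.const_mul _
  have him : IntegrableOn (fun y : ℝ => y ^ (σ - 1 - 1) * (1 + y ^ 2) ^ (-(σ / 2))) (Set.Ioi 0) :=
    integrableOn_rpow_mul_one_add_sq_rpow_neg (by linarith) (by linarith)
  refine (lintegral_le_lintegral_mul_lintegral
    (g := fun x => ENNReal.ofReal (2 ^ σ * (1 + x ^ 2) ^ (-σ / 2)))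
    (h := fun y => ENNReal.ofReal (y ^ (σ - 1 - 1) * (1 + y ^ 2) ^ (-(σ / 2))))
    (by fun_prop) (by fun_prop) fun u => ?_).trans_lt
    (ENNReal.mul_lt_top hre.lintegral_lt_top him.lintegral_lt_top)
  rw [← ENNReal.ofReal_mul (by positivity), ← ENNReal.ofReal_mul (by positivity)]
  exact ENNReal.ofReal_le_ofReal
    (sq_one_div_im_mul_cosh_dist_I_rpow_neg_le (zero_le_one.trans hσ.le) u)

lemma summable_cosh_dist_smul_rpow_neg (Γ : Subgroup PSL(2, ℝ)) [DiscreteTopology Γ] {σ : ℝ}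
    (hσ : 1 < σ) (z w : ℍ) : Summable fun η : Γ => Real.cosh (dist z (η • w)) ^ (-σ) := by
  have hσ0 : 0 ≤ σ := zero_le_one.trans hσ.le
  have hnonneg (u v : ℍ) : 0 ≤ Real.cosh (dist u v) ^ (-σ) := by positivity
  have hmeas : Measurable fun u : ℍ => ENNReal.ofReal (Real.cosh (dist I u) ^ (-σ)) := by
    fun_prop
  have hbound := tsum_smul_mul_measure_ball_le (G := Γ) volume hmeas (r := 1)
    (C := ENNReal.ofReal ((2 * Real.cosh 1) ^ σ)) (fun u v huv => by
      rw [← ENNReal.ofReal_mul (by positivity)]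
      exact ENNReal.ofReal_le_ofReal (cosh_dist_rpow_neg_le hσ0 I huv.le)) w
  have hfinite : ∑' η : Γ, ENNReal.ofReal (Real.cosh (dist I (η • w)) ^ (-σ)) ≠ ⊤ := by
    intro htop
    rw [htop, ENNReal.top_mul (Metric.measure_ball_pos volume w one_pos).ne', top_le_iff] at hbound
    refine ENNReal.mul_ne_top ENNReal.ofReal_ne_top (ENNReal.mul_ne_top ?_
      (lintegral_cosh_dist_I_rpow_neg_lt_top hσ).ne) hbound
    rw [ENat.toENNReal_ne_top, Set.encard_ne_top_iff]
    exact finite_setOf_dist_smul_lt Γ w (2 * 1)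
  have hI : Summable fun η : Γ => Real.cosh (dist I (η • w)) ^ (-σ) :=
    (ENNReal.summable_toReal hfinite).congr fun η => ENNReal.toReal_ofReal (hnonneg _ _)
  refine .of_nonneg_of_le (fun η => hnonneg _ _) (fun η => ?_)
    (hI.mul_left ((2 * Real.cosh (dist z I)) ^ σ))
  rw [dist_comm z, dist_comm I (η • w)]
  exact cosh_dist_rpow_neg_le hσ0 _ le_rfl

/-! ### The centralizer of a primitive hyperbolic element -/

lemma zpowers_eq_zpowers_of_forall_pow_ne {G : Type*} [Group G] {g h : G}
    (hg : ∀ (k : G) (n : ℕ), 2 ≤ n → k ^ n ≠ g) (hgh : g ∈ Subgroup.zpowers h) :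
    Subgroup.zpowers g = Subgroup.zpowers h := by
  obtain ⟨n, rfl⟩ := hgh
  obtain hn | hn | hn : n.natAbs = 0 ∨ n.natAbs = 1 ∨ 2 ≤ n.natAbs := by omega
  · exact absurd (by simp [Int.natAbs_eq_zero.1 hn]) (hg 1 2 le_rfl)
  · obtain rfl | rfl := Int.natAbs_eq_iff.1 hn <;> simp
  · obtain hpos | hneg := Int.natAbs_eq n
    · exact absurd (by rw [← zpow_natCast, ← hpos]) (hg h _ hn)
    · exact absurd (by rw [← zpow_natCast, inv_zpow', ← hneg]) (hg h⁻¹ _ hn)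

lemma mk_neg (A : SL(2, ℝ)) : ((-A : SL(2, ℝ)) : PSL(2, ℝ)) = A := by
  rw [eq_comm, QuotientGroup.eq, mul_neg, inv_mul_cancel]
  exact Subgroup.mem_center_iff.2 fun B => by rw [mul_neg_one, neg_one_mul]

lemma exists_eq_diagExp {A : SL(2, ℝ)} (h01 : A 0 1 = 0) (h10 : A 1 0 = 0) (h00 : 0 < A 0 0) :
    ∃ t, A = diagExp t := by
  have hdet : A 0 0 * A 1 1 = 1 := by
    have hdet := A.det_coe
    rwa [Matrix.det_fin_two, h01, zero_mul, sub_zero] at hdet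
  have hexp : Real.exp (2 * Real.log (A 0 0) / 2) = A 0 0 := by
    rw [mul_div_cancel_left₀ _ two_ne_zero, Real.exp_log h00]
  have hexp_neg : Real.exp (-(2 * Real.log (A 0 0)) / 2) = A 1 1 := by
    rw [neg_div, Real.exp_neg, hexp]
    exact inv_eq_of_mul_eq_one_right hdet
  refine ⟨2 * Real.log (A 0 0), ?_⟩
  ext i j
  fin_cases i <;> fin_cases j
  exacts [hexp.symm, h01, h10, hexp_neg.symm]

lemma exists_mk_eq_diagExp {A : SL(2, ℝ)} (h01 : A 0 1 = 0) (h10 : A 1 0 = 0) :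
    ∃ t, (A : PSL(2, ℝ)) = diagExp t := by
  have h00 : A 0 0 ≠ 0 := fun h00 => by
    have hdet := A.det_coe
    rw [Matrix.det_fin_two, h00, h01, zero_mul, zero_mul, sub_zero] at hdet
    exact zero_ne_one hdet
  obtain hneg | hpos := lt_or_gt_of_ne h00
  · obtain ⟨t, ht⟩ := exists_eq_diagExp (A := -A) (neg_eq_zero.2 h01) (neg_eq_zero.2 h10)
      (neg_pos.2 hneg)
    exact ⟨t, by rw [← ht, mk_neg]⟩
  · obtain ⟨t, rfl⟩ := exists_eq_diagExp h01 h10 hpos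
    exact ⟨t, rfl⟩

lemma exists_eq_diagExp_of_commute {ℓ : ℝ} (hℓ : ℓ ≠ 0) {g : PSL(2, ℝ)}
    (hg : Commute g (diagExp ℓ)) : ∃ t, g = (diagExp t : PSL(2, ℝ)) := by
  obtain ⟨A, rfl⟩ := QuotientGroup.mk_surjective g
  -- Representatives of commuting elements of `PSL(2, ℝ)` commute up to a sign `r`.
  have hcenter : (A * diagExp ℓ)⁻¹ * (diagExp ℓ * A) ∈ Subgroup.center SL(2, ℝ) :=
    QuotientGroup.eq.1 hg
  obtain ⟨r, hr, hscalar⟩ := Matrix.SpecialLinearGroup.mem_center_iff.1 hcenter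
  have hmul : (diagExp ℓ : Matrix (Fin 2) (Fin 2) ℝ) * A =
      A * diagExp ℓ * Matrix.scalar (Fin 2) r := by
    rw [hscalar, ← Matrix.SpecialLinearGroup.coe_mul, ← Matrix.SpecialLinearGroup.coe_mul,
      ← Matrix.SpecialLinearGroup.coe_mul, mul_inv_cancel_left]
  rw [Fintype.card_fin] at hr
  have hne : Real.exp (ℓ / 2) - r * Real.exp (-ℓ / 2) ≠ 0 := by
    obtain rfl | rfl := sq_eq_one_iff.1 hr
    · rw [one_mul, sub_ne_zero, Real.exp_injective.ne_iff]
      exact fun h => hℓ (by linarith)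
    · linarith [Real.exp_pos (ℓ / 2), Real.exp_pos (-ℓ / 2)]
  have hentry01 := congrFun₂ hmul 0 1
  have hentry10 := congrFun₂ hmul 1 0
  simp only [diagExp, Matrix.mul_apply, Fin.sum_univ_two, Matrix.of_apply, Matrix.cons_val',
    Matrix.cons_val_zero, Matrix.cons_val_one, Matrix.cons_val_fin_one, Matrix.scalar_apply,
    Matrix.diagonal_apply_eq, Matrix.diagonal_apply_ne, ne_eq, zero_ne_one, one_ne_zero,
    not_false_eq_true, zero_mul, mul_zero, zero_add, add_zero] at hentry01 hentry10
  refine exists_mk_eq_diagExp (eq_zero_of_ne_zero_of_mul_left_eq_zero hne ?_)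
    (eq_zero_of_ne_zero_of_mul_left_eq_zero hne ?_)
  · linear_combination hentry01
  · linear_combination (-r) * hentry10 - A 1 0 * Real.exp (ℓ / 2) * hr

lemma continuous_diagExp : Continuous diagExp := by
  refine Continuous.subtype_mk (continuous_matrix fun i j => ?_) _
  fin_cases i <;> fin_cases j <;> dsimp <;> fun_prop

namespace Scaling

variable {γ : PSL(2, ℝ)} (S : Scaling γ)

lemma continuous_translation : Continuous S.translation :=
  (((QuotientGroup.continuous_mk.comp continuous_diagExp).comp continuous_toAdd).const_mul
    S.σ).mul_const S.σ⁻¹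

lemma mem_range_translation_of_commute {g : PSL(2, ℝ)} (hg : Commute g γ) :
    g ∈ S.translation.range := by
  have hconj : Commute (S.σ⁻¹ * g * S.σ) (diagExp S.ℓ) := by
    rw [← S.conj_eq]
    simpa using hg.conj S.σ⁻¹
  obtain ⟨t, ht⟩ := exists_eq_diagExp_of_commute S.ℓ_pos.ne' hconj
  refine ⟨Multiplicative.ofAdd t, ?_⟩
  rw [translation_apply, toAdd_ofAdd, ← ht]
  group

lemma isCyclic_comap_translation (Γ : Subgroup PSL(2, ℝ)) [DiscreteTopology Γ] :
    IsCyclic (Γ.comap S.translation) := by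
  have : OrderTopology (Multiplicative ℝ) := inferInstanceAs (OrderTopology ℝ)
  refine Subgroup.discrete_iff_cyclic.2
    (.of_continuous_injective (f := S.translation.subgroupComap Γ) ?_ ?_)
  · exact (S.continuous_translation.comp continuous_subtype_val).subtype_mk _
  · exact fun t u htu => Subtype.ext (S.translation_injective (congrArg Subtype.val htu))

end Scaling

section

variable {Γ : Subgroup PSL(2, ℝ)} [DiscreteTopology Γ] {γ : Γ}

lemma Scaling.exists_centralizer_le_zpowers (S : Scaling (γ : PSL(2, ℝ))) :
    ∃ δ : Γ, Subgroup.centralizer {γ} ≤ Subgroup.zpowers δ := by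
  obtain ⟨b, hb⟩ := (Subgroup.isCyclic_iff_exists_zpowers_eq_top _).1
    (S.isCyclic_comap_translation Γ)
  have hbΓ : S.translation b ∈ Γ :=
    Subgroup.mem_comap.1 (hb ▸ Subgroup.mem_zpowers b)
  refine ⟨⟨S.translation b, hbΓ⟩, fun η hη => ?_⟩
  have hcomm : Commute (η : PSL(2, ℝ)) γ :=
    congrArg Subtype.val (Subgroup.mem_centralizer_singleton_iff.1 hη)
  obtain ⟨t, ht⟩ := S.mem_range_translation_of_commute hcomm
  have htb : t ∈ Subgroup.zpowers b := by
    rw [hb, Subgroup.mem_comap, ht]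
    exact η.2
  obtain ⟨n, rfl⟩ := htb
  refine ⟨n, Subtype.ext ?_⟩
  rw [← ht]
  simp

lemma stab_eq_centralizer (hprim : IsPrimitive γ) (S : Scaling (γ : PSL(2, ℝ))) :
    stab γ = Subgroup.centralizer {γ} := by
  obtain ⟨δ, hδ⟩ := S.exists_centralizer_le_zpowers
  have hγ : γ ∈ Subgroup.centralizer {γ} := Subgroup.mem_centralizer_singleton_iff.2 rfl
  refine le_antisymm (Subgroup.zpowers_le.2 hγ) ?_
  rwa [stab, zpowers_eq_zpowers_of_forall_pow_ne hprim (hδ hγ)]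

end

/-! ### Unfolding -/

lemma hasSum_intervalIntegral_comp_add_mul {E : Type*} [NormedAddCommGroup E] [NormedSpace ℝ E]
    {f : ℝ → E} (hf : Integrable f) {ℓ : ℝ} (hℓ : 0 < ℓ) :
    HasSum (fun n : ℤ => ∫ t in (0 : ℝ)..ℓ, f (t + n * ℓ)) (∫ t, f t) := by
  have hterm (n : ℤ) :
      ℓ • ∫ x in (0 : ℝ)..1, f (ℓ * (x + n)) = ∫ t in (0 : ℝ)..ℓ, f (t + n * ℓ) := by
    simp only [mul_add, mul_comm ℓ (n : ℝ)]
    rw [intervalIntegral.smul_integral_comp_mul_left (fun t => f (t + n * ℓ)), mul_zero, mul_one]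
  have htotal : ℓ • ∫ x, f (ℓ * x) = ∫ t, f t := by
    rw [Measure.integral_comp_mul_left, abs_of_pos (inv_pos.2 hℓ), smul_inv_smul₀ hℓ.ne']
  rw [← htotal]
  simp only [← hterm]
  exact (hf.comp_mul_left' hℓ.ne').hasSum_intervalIntegral_comp_add_int.const_smul ℓ

lemma bijective_inv_out_mul_zpow {G : Type*} [Group G] {g : G}
    (hg : Function.Injective fun n : ℤ => g ^ n) :
    Function.Bijective fun p : Quotient (QuotientGroup.rightRel (Subgroup.zpowers g)) × ℤ =>
      p.1.out⁻¹ * g ^ p.2 := by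
  constructor
  · rintro ⟨q, m⟩ ⟨q', n⟩ (h : q.out⁻¹ * g ^ m = q'.out⁻¹ * g ^ n)
    obtain rfl : q = q' := by
      rw [← q.out_eq, ← q'.out_eq]
      refine Quotient.sound (QuotientGroup.rightRel_apply.2 ⟨n - m, ?_⟩)
      simp only
      rw [zpow_sub, mul_inv_eq_iff_eq_mul, mul_assoc, h, mul_inv_cancel_left]
    exact Prod.ext rfl (hg (mul_left_cancel h))
  · intro h
    obtain ⟨n, hn : g ^ n = h⁻¹ * (Quotient.out _)⁻¹⟩ := QuotientGroup.rightRel_apply.1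
      (Quotient.mk_out (s := QuotientGroup.rightRel (Subgroup.zpowers g)) h⁻¹)
    refine ⟨(Quotient.mk _ h⁻¹, -n), ?_⟩
    simp only
    rw [zpow_neg, hn, mul_inv_rev, inv_inv, inv_inv, inv_mul_cancel_left]

section Kernel

variable {Γ : Subgroup PSL(2, ℝ)} {s : ℂ}

lemma norm_kernelTerm (z w : ℍ) (η : Γ) :
    ‖kernelTerm Γ s z w η‖ = Real.cosh (dist z (η • w)) ^ (-s.re) := by
  rw [kernelTerm, Complex.norm_cpow_eq_rpow_re_of_pos (Real.cosh_pos _), Complex.neg_re]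

lemma continuous_kernelTerm (z : ℍ) (η : Γ) : Continuous fun w => kernelTerm Γ s z w η := by
  have hcosh : Continuous fun w : ℍ => (Real.cosh (dist z (η • w)) : ℂ) := by fun_prop
  exact hcosh.cpow continuous_const fun w => .inl (Real.cosh_pos _)

lemma norm_kernelTerm_le (hs : 0 ≤ s.re) (z : ℍ) (η : Γ) {v w : ℍ} {r : ℝ} (hvw : dist v w ≤ r) :
    ‖kernelTerm Γ s z v η‖ ≤
      (2 * Real.cosh r) ^ s.re * Real.cosh (dist z (η • w)) ^ (-s.re) := by
  rw [norm_kernelTerm]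
  exact cosh_dist_rpow_neg_le hs z ((dist_smul η v w).trans_le hvw)

variable [DiscreteTopology Γ]

lemma summable_kernelTerm (hs : 1 < s.re) (z w : ℍ) : Summable (kernelTerm Γ s z w) :=
  .of_norm <| by
    simpa only [norm_kernelTerm] using summable_cosh_dist_smul_rpow_neg Γ hs z w

end Kernel

section Geodesic

variable {Γ : Subgroup PSL(2, ℝ)} {γ : Γ} (S : Scaling (γ : PSL(2, ℝ))) {s : ℂ}

lemma lineIntegrand_kernel (z : ℍ) (t : ℝ) :
    lineIntegrand Γ (kernel Γ s (proj Γ z)) S.path t = ∑' η, kernelTerm Γ s z (S.path t) η := by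
  rw [lineIntegrand, S.hypSpeed_path, Complex.ofReal_one, mul_one]
  rfl

lemma norm_kernelTerm_path_le (hs : 0 ≤ s.re) (z : ℍ) (η : Γ) {t : ℝ}
    (ht : t ∈ Set.uIcc 0 S.ℓ) :
    ‖kernelTerm Γ s z (S.path t) η‖ ≤
      (2 * Real.cosh S.ℓ) ^ s.re * Real.cosh (dist z (η • S.path 0)) ^ (-s.re) := by
  rw [Set.uIcc_of_le S.ℓ_pos.le] at ht
  refine norm_kernelTerm_le hs z η ?_
  rw [S.isometry_path.dist_eq, Real.dist_0_eq_abs, abs_of_nonneg ht.1]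
  exact ht.2

lemma kernelTerm_inv_mul_zpow_path (z : ℍ) (a : Γ) (n : ℤ) (t : ℝ) :
    kernelTerm Γ s z (S.path t) (a⁻¹ * γ ^ n) =
      (Real.cosh (Metric.infDist (a • z) S.axis) : ℂ) ^ (-s) *
        (Real.cosh (t + n * S.ℓ - S.foot (a • z)) : ℂ) ^ (-s) := by
  have hsmul : (a⁻¹ * γ ^ n) • S.path t = a⁻¹ • S.path (t + n * S.ℓ) := by
    rw [mul_smul, ← S.zpow_smul_path]
    rfl
  rw [kernelTerm, hsmul, ← dist_smul a, smul_inv_smul, S.cosh_dist_path, Complex.ofReal_mul,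
    Complex.mul_cpow_ofReal_nonneg (Real.cosh_pos _).le (Real.cosh_pos _).le]

lemma hasSum_intervalIntegral_kernelTerm_coset (hs : 0 < s.re) (z : ℍ) (q : Cosets γ) :
    HasSum (fun n : ℤ => ∫ t in (0 : ℝ)..S.ℓ, kernelTerm Γ s z (S.path t) (q.out⁻¹ * γ ^ n))
      ((∫ t : ℝ, (Real.cosh t : ℂ) ^ (-s)) * eisTerm S s z q) := by
  have hq : eisTerm S s z q = (Real.cosh (Metric.infDist (q.out • z) S.axis) : ℂ) ^ (-s) := by
    conv_lhs => rw [← q.out_eq]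
    rfl
  have hint := ((integrable_cosh_cpow_neg hs).comp_sub_right (S.foot (q.out • z))).const_mul
    (eisTerm S s z q)
  have hunfold := hasSum_intervalIntegral_comp_add_mul hint S.ℓ_pos
  rw [integral_const_mul, integral_sub_right_eq_self fun t : ℝ => (Real.cosh t : ℂ) ^ (-s),
    mul_comm] at hunfold
  simpa only [kernelTerm_inv_mul_zpow_path, hq] using hunfold

variable [DiscreteTopology Γ]

lemma intervalIntegrable_lineIntegrand_kernel (hs : 1 < s.re) (z : ℍ) :
    IntervalIntegrable (lineIntegrand Γ (kernel Γ s (proj Γ z)) S.path) volume 0 S.ℓ := by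
  refine ContinuousOn.intervalIntegrable ?_
  simp only [funext (lineIntegrand_kernel S z)]
  exact continuousOn_tsum
    (fun η => ((continuous_kernelTerm z η).comp S.isometry_path.continuous).continuousOn)
    ((summable_cosh_dist_smul_rpow_neg Γ hs z (S.path 0)).mul_left _)
    fun η t ht => norm_kernelTerm_path_le S (zero_le_one.trans hs.le) z η ht

lemma hasSum_intervalIntegral_kernelTerm (hs : 1 < s.re) (z : ℍ) :
    HasSum (fun η : Γ => ∫ t in (0 : ℝ)..S.ℓ, kernelTerm Γ s z (S.path t) η)
      (closedGeodesicIntegral Γ S (kernel Γ s (proj Γ z))) := by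
  refine intervalIntegral.hasSum_integral_of_dominated_convergence
    (fun η _ => (2 * Real.cosh S.ℓ) ^ s.re * Real.cosh (dist z (η • S.path 0)) ^ (-s.re))
    (fun η => ((continuous_kernelTerm z η).comp S.isometry_path.continuous).aestronglyMeasurable)
    (fun η => .of_forall fun t ht => ?_) (.of_forall fun t _ => ?_) intervalIntegrable_const
    (.of_forall fun t _ => ?_)
  · exact norm_kernelTerm_path_le S (zero_le_one.trans hs.le) z η (Set.uIoc_subset_uIcc ht)
  · exact (summable_cosh_dist_smul_rpow_neg Γ hs z (S.path 0)).mul_left _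
  · rw [lineIntegrand_kernel]
    exact (summable_kernelTerm hs z (S.path t)).hasSum

lemma hasSum_eisTerm (hs : 1 < s.re) (z : ℍ) :
    HasSum (fun q => (∫ t : ℝ, (Real.cosh t : ℂ) ^ (-s)) * eisTerm S s z q)
      (closedGeodesicIntegral Γ S (kernel Γ s (proj Γ z))) := by
  have hbij := bijective_inv_out_mul_zpow (g := γ) fun m n hmn =>
    S.zpow_injective (congrArg Subtype.val hmn)
  exact ((Equiv.ofBijective _ hbij).hasSum_iff.2
    (hasSum_intervalIntegral_kernelTerm S hs z)).prod_fiberwise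
      (hasSum_intervalIntegral_kernelTerm_coset S (zero_lt_one.trans hs) z)

end Geodesic

end HypEis

theorem mainTheorem6_general (Γ : Subgroup PSL(2, ℝ)) [DiscreteTopology Γ] (γ : Γ)
    (hprim : IsPrimitive γ) (S : Scaling (γ : PSL(2, ℝ))) (s : ℂ) (hs : 1 < s.re) :
    stab γ = Subgroup.centralizer {γ} ∧
    ∀ z : ℍ,
      (∀ w : ℍ, Summable (kernelTerm Γ s z w)) ∧
      Summable (eisTerm S s z) ∧
      IntervalIntegrable (lineIntegrand Γ (kernel Γ s (proj Γ z)) S.path) volume 0 S.ℓ ∧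
      closedGeodesicIntegral Γ S (fun w => kernel Γ s (proj Γ z) w) =
        (2 : ℂ) ^ (s - 1) * Complex.Gamma (s / 2) ^ 2 / Complex.Gamma s *
          eisenstein S s (proj Γ z) := by
  have hs0 : 0 < s.re := zero_lt_one.trans hs
  refine ⟨stab_eq_centralizer hprim S, fun z => ⟨summable_kernelTerm hs z, ?_,
    intervalIntegrable_lineIntegrand_kernel S hs z, ?_⟩⟩
  · exact (summable_mul_left_iff (integral_cosh_cpow_neg_ne_zero hs0)).1
      (hasSum_eisTerm S hs z).summable
  · rw [← integral_cosh_cpow_neg hs0, ← (hasSum_eisTerm S hs z).tsum_eq, tsum_mul_left]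
    rfl

theorem mainTheorem6 (Γ : Subgroup PSL(2, ℝ)) (hΓ : IsFuchsianFirstKind Γ)
    (γ : Γ) (hγ : IsHyperbolic (γ : PSL(2, ℝ))) (hprim : IsPrimitive γ)
    (S : Scaling (γ : PSL(2, ℝ))) (s : ℂ) (hs : 1 < s.re) :
    -- `Γ_γ = ⟨γ⟩` is the stabilizer of `γ` in `Γ`
    stab γ = Subgroup.centralizer {γ} ∧
    ∀ z : ℍ,
      -- absolute convergence of the series and of the integral
      (∀ w : ℍ, Summable (kernelTerm Γ s z w)) ∧
      Summable (eisTerm S s z) ∧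
      IntervalIntegrable (lineIntegrand Γ (kernel Γ s (proj Γ z)) S.path) volume 0 S.ℓ ∧
      -- the integral formula
      closedGeodesicIntegral Γ S (fun w => kernel Γ s (proj Γ z) w) =
        (2 : ℂ) ^ (s - 1) * Complex.Gamma (s / 2) ^ 2 / Complex.Gamma s *
          eisenstein S s (proj Γ z) :=
  have := hΓ.discrete
  mainTheorem6_general Γ γ hprim S s hs
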